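/- Let $T>0$, $p\le n$, $\phi:\mathbb{R}^n\times[0,T]\to\mathbb{R}$ and $h=(h_1,\dots,h_p):\mathbb{R}^n\times[0,T]\to\mathbb{R}^p$. Write $P(z)=\int_0^T\phi(z(t),t)\,dt$ (Lebesgue integral) and $\Omega=\{z\in L_\infty([0,T];\mathbb{R}^n) : h(z(t),t)=0 \text{ for a.e. } t\in[0,T]\}$. All gradients, Jacobians and Hessians are taken with respect to $z$. Let $\bar z\in\Omega$ be a local optimal solution of the problem of maximizing $P$ over $\Omega$: $P(\bar z)$ is finite, and there is $\epsilon_0>0$ such that $P(\bar z)\ge P(z)$ for all $z\in\Omega$ with $\|z-\bar z\|_\infty\le\epsilon_0$ for which the integral $P(z)$ exists and is finite. Let $\epsilon>0$, let $\bar B$ be the closed unit ball of $\mathbb{R}^n$, and write $\nabla\bar\phi(t)=\nabla\phi(\bar z(t),t)$, $\nabla\bar h(t)=\nabla h(\bar z(t),t)\in\mathbb{R}^{p\times n}$, and similarly for $\nabla^2\bar\phi$, $\nabla\bar h_i$, $\nabla^2\bar h_i$. Assume: (H1) $\phi(\cdot,t)$ is twice continuously differentiable for every $t\in[0,T]$,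 $\phi(z,\cdot)$ is measurable for each $z$, and there is $K_\phi>0$ with $\|\nabla\bar\phi(t)\|\le K_\phi$ for a.e. $t\in[0,T]$. (H2) $h(z,\cdot)$ is measurable for each $z$, and $h(\cdot,t)$ is twice continuously differentiable on $\bar z(t)+\epsilon\bar B$ for a.e. $t\in[0,T]$. (H3) There is an increasing function $\theta:(0,\infty)\to(0,\infty)$ with $\theta(s)\downarrow0$ as $s\downarrow0$ such that for a.e. $t\in[0,T]$ and all $\tilde z\ne z$ in $\bar z(t)+\epsilon\bar B$, $\|\nabla h(\tilde z,t)-\nabla h(z,t)\|\le\theta(\|\tilde z-z\|)$; and there is $K_0>0$ with $\|\nabla\bar h(t)\|\le K_0$ for a.e. $t\in[0,T]$. (H4) There is $K>0$ with $\det\{\nabla\bar h(t)\nabla\bar h'(t)\}\ge K$ for a.e. $t\in[0,T]$. Then there is a unique $u\in L_\infty([0,T];\mathbb{R}^p)$ such that $$\nabla\bar\phi(t)+\sum_{i=1}^p u_i(t)\nabla\bar h_i(t)=0\quad\text{for a.e. } t\in[0,T].$$ Moreover, for this $u$ and for every $\gamma\in L_\infty([0,T];\mathbb{R}^n)$ with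 $\nabla\bar h(t)\gamma(t)=0$ for a.e. $t\in[0,T]$, $$\int_0^T\gamma'(t)\Big\{\nabla^2\bar\phi(t)+\sum_{i=1}^p u_i(t)\nabla^2\bar h_i(t)\Big\}\gamma(t)\,dt\le0,$$ where the integrand is measurable with integrable positive part, so that the integral exists in $[-\infty,\infty)$. -/

import Mathlib

open MeasureTheory Filter Topology
open scoped ENNReal

noncomputable section

namespace ContTimeOpt

/-- The Euclidean space `ℝⁿ`. -/
abbrev Vec (n : ℕ) : Type := EuclideanSpace ℝ (Fin n)

/-- Lebesgue measure on the interval `[0, T]`. -/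
abbrev timeMeasure (T : ℝ) : Measure ℝ := volume.restrict (Set.Icc 0 T)

/-- The space `L_∞([0,T]; ℝⁿ)` with the essential supremum norm. -/
abbrev LInf (T : ℝ) (n : ℕ) : Type := Lp (Vec n) ∞ (timeMeasure T)

/-- The Hessian `∇²f(x)`, as the linear operator `v ↦ ∇²f(x) v` on `ℝⁿ`
(the derivative of the gradient field). -/
def hessian {n : ℕ} (f : Vec n → ℝ) (x : Vec n) : Vec n →L[ℝ] Vec n :=
  fderiv ℝ (fun y => gradient f y) x

/-- The Jacobian `∇f(x)`, as a linear map `ℝⁿ → ℝᵖ`. -/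
def jacobian {n p : ℕ} (f : Vec n → Vec p) (x : Vec n) : Vec n →L[ℝ] Vec p :=
  fderiv ℝ f x

/-- The determinant of `A A'` for a linear map `A : ℝⁿ → ℝᵖ`
(the Euclidean adjoint of `A` is its transpose). -/
def gramDet {n p : ℕ} (A : Vec n →L[ℝ] Vec p) : ℝ :=
  (A ∘L ContinuousLinearMap.adjoint A).det

/-- The Lebesgue integral of `f` as an extended real number, `∫ f⁺ - ∫ f⁻`.
It is meaningful for measurable `f` as soon as one of the two terms is finite. -/
def extIntegral (f : ℝ → ℝ) (μ : Measure ℝ) : EReal :=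
  ((∫⁻ t, ENNReal.ofReal (f t) ∂μ : ℝ≥0∞) : EReal)
    - ((∫⁻ t, ENNReal.ofReal (-f t) ∂μ : ℝ≥0∞) : EReal)

/-- For integrable functions the extended integral is the usual integral. -/
theorem extIntegral_eq_integral {f : ℝ → ℝ} {μ : Measure ℝ} (hf : Integrable f μ) :
    extIntegral f μ = ((∫ t, f t ∂μ : ℝ) : EReal) := by
  have h1 : ∫⁻ t, ENNReal.ofReal (f t) ∂μ ≠ ∞ := hf.lintegral_lt_top.ne
  have h2 : ∫⁻ t, ENNReal.ofReal (-f t) ∂μ ≠ ∞ := hf.neg.lintegral_lt_top.ne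
  rw [integral_eq_lintegral_pos_part_sub_lintegral_neg_part hf, extIntegral, EReal.coe_sub,
    EReal.coe_ennreal_toReal h1, EReal.coe_ennreal_toReal h2]

/-- The objective functional `P(z) = ∫₀ᵀ φ(z(t), t) dt`. -/
def objective {T : ℝ} {n : ℕ} (φ : Vec n → ℝ → ℝ) (z : LInf T n) : ℝ :=
  ∫ t, φ (z t) t ∂(timeMeasure T)

/-- The objective is finite at `z`: the integral defining `P(z)` exists. -/
def ObjectiveFinite {T : ℝ} {n : ℕ} (φ : Vec n → ℝ → ℝ) (z : LInf T n) : Prop :=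
  Integrable (fun t => φ (z t) t) (timeMeasure T)

/-- The feasible set `Ω = {z ∈ L_∞ | h(z(t), t) = 0 a.e.}`. -/
def feasible {n p : ℕ} (T : ℝ) (h : Vec n → ℝ → Vec p) : Set (LInf T n) :=
  {z | ∀ᵐ t ∂(timeMeasure T), h (z t) t = 0}

/-- `zbar` is a local optimal solution: it is feasible, `P(zbar)` is finite, and
`P(zbar) ≥ P(z)` for all feasible `z` in some closed `L_∞`-ball around `zbar` at which
`P(z)` is finite. (Where the integral defining `P(z)` does not exist, nothing is required.) -/
def IsLocalSolution {T : ℝ} {n p : ℕ} (φ : Vec n → ℝ → ℝ) (h : Vec n → ℝ → Vec p)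
    (zbar : LInf T n) : Prop :=
  zbar ∈ feasible T h ∧ ObjectiveFinite φ zbar ∧
    ∃ ε : ℝ, 0 < ε ∧ ∀ z ∈ feasible T h, ‖z - zbar‖ ≤ ε → ObjectiveFinite φ z →
      objective φ z ≤ objective φ zbar

/-- (H1): `φ(·,t)` is twice continuously differentiable for every `t ∈ [0,T]`, `φ(z,·)` is
Lebesgue measurable for each `z`, and `∇φ(zbar(t),t)` is essentially bounded. -/
def H1 {T : ℝ} {n : ℕ} (φ : Vec n → ℝ → ℝ) (zbar : LInf T n) : Prop :=
  (∀ t ∈ Set.Icc 0 T, ContDiff ℝ 2 (fun x => φ x t)) ∧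
  (∀ x, AEMeasurable (fun t => φ x t) (timeMeasure T)) ∧
  ∃ Kφ : ℝ, 0 < Kφ ∧ ∀ᵐ t ∂(timeMeasure T), ‖gradient (fun x => φ x t) (zbar t)‖ ≤ Kφ

/-- (H2): `h(z,·)` is Lebesgue measurable for each `z`, and for a.e. `t` the map `h(·,t)` is
twice continuously differentiable on the closed ball `zbar(t) + ε B`. -/
def H2 {T : ℝ} {n p : ℕ} (h : Vec n → ℝ → Vec p) (zbar : LInf T n) (ε : ℝ) : Prop :=
  (∀ x, AEMeasurable (fun t => h x t) (timeMeasure T)) ∧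
  ∀ᵐ t ∂(timeMeasure T), ContDiffOn ℝ 2 (fun x => h x t) (Metric.closedBall (zbar t) ε)

/-- (H3): `∇h(·,t)` has on the closed ball `zbar(t) + ε B` a modulus of continuity `θ` that does
not depend on `t`, and `∇h(zbar(t),t)` is essentially bounded. The derivative relative to the
ball is the derivative itself in the interior, and its continuous extension on the sphere. -/
def H3 {T : ℝ} {n p : ℕ} (h : Vec n → ℝ → Vec p) (zbar : LInf T n) (ε : ℝ) : Prop :=
  (∃ θ : ℝ → ℝ, MonotoneOn θ (Set.Ioi 0) ∧ (∀ s, 0 < s → 0 < θ s) ∧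
    Tendsto θ (𝓝[>] 0) (𝓝 0) ∧
    ∀ᵐ t ∂(timeMeasure T),
      ∀ x ∈ Metric.closedBall (zbar t) ε, ∀ y ∈ Metric.closedBall (zbar t) ε, x ≠ y →
        ‖fderivWithin ℝ (fun w => h w t) (Metric.closedBall (zbar t) ε) x
          - fderivWithin ℝ (fun w => h w t) (Metric.closedBall (zbar t) ε) y‖ ≤ θ ‖x - y‖) ∧
  ∃ K₀ : ℝ, 0 < K₀ ∧ ∀ᵐ t ∂(timeMeasure T), ‖jacobian (fun x => h x t) (zbar t)‖ ≤ K₀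

/-- (H4), uniform full rank: `det (∇h(zbar(t),t) ∇h(zbar(t),t)') ≥ K > 0` for a.e. `t`. -/
def H4 {T : ℝ} {n p : ℕ} (h : Vec n → ℝ → Vec p) (zbar : LInf T n) : Prop :=
  ∃ K : ℝ, 0 < K ∧ ∀ᵐ t ∂(timeMeasure T), K ≤ gramDet (jacobian (fun x => h x t) (zbar t))

/-- The first order condition `∇φ(zbar(t),t) + ∑ᵢ uᵢ(t) ∇hᵢ(zbar(t),t) = 0` a.e. -/
def Stationary {T : ℝ} {n p : ℕ} (φ : Vec n → ℝ → ℝ) (h : Vec n → ℝ → Vec p)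
    (zbar : LInf T n) (u : LInf T p) : Prop :=
  ∀ᵐ t ∂(timeMeasure T),
    gradient (fun x => φ x t) (zbar t)
      + ∑ i : Fin p, u t i • gradient (fun x => h x t i) (zbar t) = 0

/-- The integrand `γ'(t) {∇²φ(zbar(t),t) + ∑ᵢ uᵢ(t) ∇²hᵢ(zbar(t),t)} γ(t)`. -/
def secondVariation {T : ℝ} {n p : ℕ} (φ : Vec n → ℝ → ℝ) (h : Vec n → ℝ → Vec p)
    (zbar : LInf T n) (u : LInf T p) (γ : LInf T n) (t : ℝ) : ℝ :=
  inner ℝ (γ t)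
    ((hessian (fun x => φ x t) (zbar t)
      + ∑ i : Fin p, u t i • hessian (fun x => h x t i) (zbar t)) (γ t))

/-- The set `N` of all `γ ∈ L_∞` with `∇h(zbar(t),t) γ(t) = 0` a.e. -/
def criticalDirections {T : ℝ} {n p : ℕ} (h : Vec n → ℝ → Vec p) (zbar : LInf T n) :
    Set (LInf T n) :=
  {γ | ∀ᵐ t ∂(timeMeasure T), jacobian (fun x => h x t) (zbar t) (γ t) = 0}

end ContTimeOpt

end

noncomputable section

namespace ContTimeOpt

/-! The infinite-dimensional problem reduces to a family of finite-dimensional ones, one for almost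
every time `t`, and the classical multiplier rules are applied to each separately.

The reduction is `ae_pointwise_local_solution`: for one radius `r` and almost every `t`, the point
`zbar t` maximizes `φ(·,t)` over the zeros of `h(·,t)` in the closed ball of radius `r`. Otherwise,
for some `k`, the times at which a feasible point of the ball improves the integrand by at least
`1/(k+1)` do not form a null set. A measurable selection of such points
(`exists_aemeasurable_zero`), switched on over a suitable subset of positive measure, yields a
competitor in `L_∞` with finite and strictly larger objective (`measure_eq_zero_of_improvement`).

At a fixed `t`, write `A` for the Jacobian of `h` and `g` for the gradient of `φ`. Since `A A'` is
invertible, `A` is onto, so a multiplier `u` with `g + A' u = 0` exists and must equal `-(A A')⁻¹ A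
g`. This formula gives uniqueness and measurability, and also boundedness, because `(A, g)` stays in
a compact set on which the formula is continuous. The second-order condition follows by expanding
the Lagrangian along a curve in the level set tangent to `γ(t)`. The curve may depend on `t`
arbitrarily: only the resulting inequality is used, and it makes the second variation nonpositive
almost everywhere, hence also after integration. -/

/-! ### Measurable selections -/

/-- A sequence of codes of points of a dense sequence can be refined measurably. -/
theorem exists_measurable_refinement {α E : Type*} [MeasurableSpace α] [MetricSpace E]
    {d : ℕ → E} (hd : DenseRange d) {Z : α → Set E} (hne : ∀ t, (Z t).Nonempty)
    (hZ : ∀ x, Measurable fun t => Metric.infDist x (Z t)) {r s : ℝ} (hs : 0 < s)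
    {N : α → ℕ} (hN : Measurable N) (hNr : ∀ t, Metric.infDist (d (N t)) (Z t) < r) :
    ∃ M : α → ℕ, Measurable M ∧ (∀ t, Metric.infDist (d (M t)) (Z t) < s) ∧
      ∀ t, dist (d (M t)) (d (N t)) < r + s := by
  classical
  have hex : ∀ t, ∃ j, Metric.infDist (d j) (Z t) < s ∧ dist (d j) (d (N t)) < r + s := by
    intro t
    obtain ⟨z, hz, hzr⟩ := (Metric.infDist_lt_iff (hne t)).1 (hNr t)
    obtain ⟨j, hj⟩ := hd.exists_dist_lt z hs
    refine ⟨j, (Metric.infDist_le_dist_of_mem hz).trans_lt (by rwa [dist_comm]), ?_⟩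
    calc dist (d j) (d (N t)) ≤ dist (d j) z + dist z (d (N t)) := dist_triangle _ _ _
      _ < r + s := by rw [dist_comm (d j) z, dist_comm z (d (N t))]; linarith
  -- Choosing the least admissible index makes the choice measurable.
  refine ⟨fun t => Nat.find (hex t), measurable_find hex fun j => ?_,
    fun t => (Nat.find_spec (hex t)).1, fun t => (Nat.find_spec (hex t)).2⟩
  refine (measurableSet_lt (hZ _) measurable_const).inter ?_
  exact (measurable_from_nat (f := fun k => dist (d j) (d k))).comp hN
    measurableSet_Iio

/-- **Kuratowski–Ryll-Nardzewski**: a nonempty closed-valued multifunction whose distance functions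
are measurable has a measurable selection. -/
theorem exists_measurable_selection {α E : Type*} [MeasurableSpace α] [MetricSpace E]
    [CompleteSpace E] [SecondCountableTopology E] [MeasurableSpace E] [BorelSpace E] [Nonempty E]
    {Z : α → Set E} (hne : ∀ t, (Z t).Nonempty) (hcl : ∀ t, IsClosed (Z t))
    (hZ : ∀ x, Measurable fun t => Metric.infDist x (Z t)) :
    ∃ x : α → E, Measurable x ∧ ∀ t, x t ∈ Z t := by
  classical
  have hd := TopologicalSpace.denseRange_denseSeq E
  set d := TopologicalSpace.denseSeq E
  let r : ℕ → ℝ := fun k => (1 / 2 : ℝ) ^ k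
  have hr : ∀ k, 0 < r k := fun k => by positivity
  let S := fun k => {N : α → ℕ // Measurable N ∧ ∀ t, Metric.infDist (d (N t)) (Z t) < r k}
  have h0 : Nonempty (S 0) := by
    have hex : ∀ t, ∃ j, Metric.infDist (d j) (Z t) < r 0 := by
      intro t
      obtain ⟨z, hz⟩ := hne t
      obtain ⟨j, hj⟩ := hd.exists_dist_lt z (hr 0)
      exact ⟨j, (Metric.infDist_le_dist_of_mem hz).trans_lt (by rwa [dist_comm])⟩
    exact ⟨fun t => Nat.find (hex t), measurable_find hex fun j =>
      measurableSet_lt (hZ _) measurable_const, fun t => Nat.find_spec (hex t)⟩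
  have hstep : ∀ k (N : S k), ∃ M : S (k + 1),
      ∀ t, dist (d (M.1 t)) (d (N.1 t)) < r k + r (k + 1) := fun k N => by
    obtain ⟨M, h1, h2, h3⟩ := exists_measurable_refinement hd hne hZ (hr (k + 1)) N.2.1 N.2.2
    exact ⟨⟨M, h1, h2⟩, h3⟩
  choose next hnext using hstep
  let N : ∀ k, S k := fun k => Nat.rec h0.some (fun k M => next k M) k
  -- Consecutive approximations differ by less than `r k + r (k+1) = (3/2) * 2⁻ᵏ`, so they form a
  -- Cauchy sequence; their distances to `Z t` tend to 0.
  have hN : ∀ k t, dist (d ((N k).1 t)) (d ((N (k + 1)).1 t)) ≤ 2 * (1 / 2 : ℝ) ^ k := by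
    intro k t
    rw [dist_comm]
    refine (hnext k (N k) t).le.trans ?_
    have := hr k
    simp only [r, pow_succ] at *
    linarith
  have hlim : ∀ t, ∃ x, Tendsto (fun k => d ((N k).1 t)) atTop (𝓝 x) := fun t =>
    cauchySeq_tendsto_of_complete
      (cauchySeq_of_le_geometric (1 / 2 : ℝ) 2 (by norm_num) fun k => hN k t)
  choose x hx using hlim
  refine ⟨x, measurable_of_tendsto_metrizable (f := fun k t => d ((N k).1 t))
    (fun k => measurable_from_nat.comp (N k).2.1) (tendsto_pi_nhds.2 hx), fun t => ?_⟩
  rw [(hcl t).mem_iff_infDist_zero (hne t)]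
  have h1 : Tendsto (fun k => Metric.infDist (d ((N k).1 t)) (Z t)) atTop
      (𝓝 (Metric.infDist (x t) (Z t))) :=
    ((Metric.continuous_infDist_pt (Z t)).tendsto _).comp (hx t)
  have h2 : Tendsto (fun k => Metric.infDist (d ((N k).1 t)) (Z t)) atTop (𝓝 0) :=
    squeeze_zero (fun k => Metric.infDist_nonneg) (fun k => ((N k).2.2 t).le)
      (tendsto_pow_atTop_nhds_zero_of_lt_one (by norm_num) (by norm_num))
  exact tendsto_nhds_unique h1 h2

/-- The set of parameters for which a Carathéodory function has a zero in a compact set. -/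
theorem measurableSet_exists_zero {α E : Type*} [MeasurableSpace α] [MetricSpace E]
    {C : Set E} (hC : IsCompact C) {F : E → α → ℝ} (hF : ∀ x ∈ C, Measurable (F x))
    (hc : ∀ t, ContinuousOn (fun x => F x t) C) (h0 : ∀ x t, 0 ≤ F x t) :
    MeasurableSet {t | ∃ x ∈ C, F x t = 0} := by
  obtain ⟨s, hsC, hsc, hCs⟩ := hC.isSeparable.exists_countable_dense_subset
  -- By compactness a zero exists iff the infimum over `C` is 0, and by continuity this can be
  -- tested on a countable dense subset.
  have key : {t | ∃ x ∈ C, F x t = 0} = ⋂ k : ℕ, ⋃ x ∈ s, {t | F x t < 1 / ((k : ℝ) + 1)} := by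
    ext t
    simp only [Set.mem_ofPred_eq, Set.mem_iInter, Set.mem_iUnion, exists_prop]
    constructor
    · rintro ⟨x, hx, hxt⟩ k
      have hpos : (0 : ℝ) < 1 / ((k : ℝ) + 1) := by positivity
      have hev : ∀ᶠ y in 𝓝[C] x, F y t < 1 / ((k : ℝ) + 1) :=
        (hc t x hx).eventually_lt_const (by simpa only [hxt] using hpos)
      obtain ⟨u, hu, huC⟩ := mem_nhdsWithin_iff_exists_mem_nhds_inter.1 hev
      obtain ⟨y, hyu, hys⟩ := mem_closure_iff_nhds.1 (hCs hx) u hu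
      exact ⟨y, hys, huC ⟨hyu, hsC hys⟩⟩
    · intro h
      obtain ⟨y, hy, -⟩ := h 0
      obtain ⟨x, hx, hmin⟩ := hC.exists_isMinOn ⟨y, hsC hy⟩ (hc t)
      refine ⟨x, hx, (h0 x t).antisymm' (le_of_forall_pos_lt_add fun e he => ?_)⟩
      obtain ⟨k, hk⟩ := exists_nat_one_div_lt he
      obtain ⟨z, hz, hzk⟩ := h k
      have := hmin (hsC hz)
      simp only [Set.mem_ofPred_eq] at this
      linarith
  rw [key]
  exact MeasurableSet.iInter fun k => MeasurableSet.biUnion hsc fun x hx =>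
    measurableSet_lt (hF x (hsC hx)) measurable_const

/-- Measurable selection of zeros of a Carathéodory function on a compact set. -/
theorem exists_measurable_zero {α E : Type*} [MeasurableSpace α] [MetricSpace E]
    [CompleteSpace E] [SecondCountableTopology E] [MeasurableSpace E] [BorelSpace E] [Nonempty E]
    {K : Set E} (hK : IsCompact K) {F : E → α → ℝ} (hF : ∀ x ∈ K, Measurable (F x))
    (hc : ∀ t, ContinuousOn (fun x => F x t) K) (h0 : ∀ x t, 0 ≤ F x t) :
    ∃ x : α → E, Measurable x ∧ ∀ t, (∃ y ∈ K, F y t = 0) → x t ∈ K ∧ F (x t) t = 0 := by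
  classical
  let A : Set α := {t | ∃ y ∈ K, F y t = 0}
  have hA : MeasurableSet A := measurableSet_exists_zero hK hF hc h0
  let e : E := Classical.arbitrary E
  -- Where there is no zero, a dummy singleton keeps the multifunction nonempty-valued.
  let Z : α → Set E := fun t => if t ∈ A then {y ∈ K | F y t = 0} else {e}
  have hZA : ∀ t ∈ A, Z t = {y ∈ K | F y t = 0} := fun t ht => if_pos ht
  have hZA' : ∀ t ∉ A, Z t = {e} := fun t ht => if_neg ht
  have hne : ∀ t, (Z t).Nonempty := by
    intro t
    by_cases ht : t ∈ A
    · rw [hZA t ht]; exact ht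
    · rw [hZA' t ht]; exact Set.singleton_nonempty e
  have hcl : ∀ t, IsClosed (Z t) := by
    intro t
    by_cases ht : t ∈ A
    · rw [hZA t ht]
      exact (hc t).preimage_isClosed_of_isClosed hK.isClosed isClosed_singleton
    · rw [hZA' t ht]; exact isClosed_singleton
  have hmeas : ∀ x, Measurable fun t => Metric.infDist x (Z t) := by
    intro x
    refine measurable_of_Iio fun c => ?_
    -- A distance below `c` means a zero within some rational radius `q < c`; closed balls keep the
    -- search set compact.
    have : (fun t => Metric.infDist x (Z t)) ⁻¹' Set.Iio c =
        (A ∩ ⋃ q : {q : ℚ // (q : ℝ) < c},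
          {t | ∃ y ∈ K ∩ Metric.closedBall x (q : ℚ), F y t = 0}) ∪
        (Aᶜ ∩ {_t | dist x e < c}) := by
      ext t
      simp only [Set.mem_preimage, Set.mem_Iio, Metric.infDist_lt_iff (hne t)]
      by_cases ht : t ∈ A
      · simp only [hZA t ht, Set.mem_union, Set.mem_inter_iff, ht, true_and, Set.mem_iUnion,
          Set.mem_compl_iff, not_true_eq_false, false_and, or_false, Set.mem_ofPred_eq]
        constructor
        · rintro ⟨y, ⟨hy, hyt⟩, hxy⟩
          obtain ⟨q, hq1, hq2⟩ := exists_rat_btwn hxy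
          exact ⟨⟨q, hq2⟩, y, ⟨hy, by rw [Metric.mem_closedBall, dist_comm]; exact hq1.le⟩, hyt⟩
        · rintro ⟨⟨q, hq⟩, y, ⟨hy, hyq⟩, hyt⟩
          rw [Metric.mem_closedBall, dist_comm] at hyq
          exact ⟨y, ⟨hy, hyt⟩, hyq.trans_lt hq⟩
      · simp [hZA' t ht, ht]
    rw [this]
    refine (hA.inter (MeasurableSet.iUnion fun q => ?_)).union
      (hA.compl.inter (MeasurableSet.const _))
    exact measurableSet_exists_zero (hK.inter_right Metric.isClosed_closedBall)
      (fun x hx => hF x hx.1) (fun t => (hc t).mono Set.inter_subset_left) h0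
  obtain ⟨x, hx, hxZ⟩ := exists_measurable_selection hne hcl hmeas
  refine ⟨x, hx, fun t ht => ?_⟩
  have := hxZ t
  rwa [hZA t ht] at this

/-- Measurable selection of zeros of a Carathéodory function on a compact set, up to null sets. -/
theorem exists_aemeasurable_zero {α E : Type*} [MeasurableSpace α] {μ : Measure α} [MetricSpace E]
    [CompleteSpace E] [SecondCountableTopology E] [MeasurableSpace E] [BorelSpace E] [Nonempty E]
    {K : Set E} (hK : IsCompact K) {F : E → α → ℝ} (hF : ∀ x ∈ K, AEMeasurable (F x) μ)
    (hc : ∀ᵐ t ∂μ, ContinuousOn (fun x => F x t) K) (h0 : ∀ x t, 0 ≤ F x t) :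
    NullMeasurableSet {t | ∃ y ∈ K, F y t = 0} μ ∧
    ∃ x : α → E, AEMeasurable x μ ∧
      ∀ᵐ t ∂μ, (∃ y ∈ K, F y t = 0) → x t ∈ K ∧ F (x t) t = 0 := by
  classical
  -- At the exceptional times `F` is replaced by the constant 1, so that continuity holds
  -- everywhere. Over `NullMeasurableSpace` almost everywhere measurability becomes plain
  -- measurability, and the previous lemmas apply.
  let G : E → α → ℝ := fun x t => if ContinuousOn (fun x => F x t) K then F x t else 1
  have hGF : ∀ᵐ t ∂μ, ∀ x, G x t = F x t := by
    filter_upwards [hc] with t ht x using if_pos ht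
  have hG : ∀ x ∈ K, Measurable[inferInstanceAs (MeasurableSpace (NullMeasurableSpace α μ))]
      (G x) := fun x hx =>
    ((hF x hx).congr (by filter_upwards [hGF] with t ht using (ht x).symm)).nullMeasurable
  have hGc : ∀ t, ContinuousOn (fun x => G x t) K := by
    intro t
    by_cases ht : ContinuousOn (fun x => F x t) K
    · simpa only [G, if_pos ht] using ht
    · simpa only [G, if_neg ht] using continuousOn_const
  have hG0 : ∀ x t, 0 ≤ G x t := by
    intro x t
    by_cases ht : ContinuousOn (fun x => F x t) K
    · simpa only [G, if_pos ht] using h0 x t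
    · simp only [G, if_neg ht]; norm_num
  constructor
  · have h1 : NullMeasurableSet {t | ∃ y ∈ K, G y t = 0} μ :=
      measurableSet_exists_zero (α := NullMeasurableSpace α μ) hK hG hGc hG0
    refine h1.congr ?_
    filter_upwards [hGF] with t ht
    refine propext ?_
    change (∃ y ∈ K, G y t = 0) ↔ (∃ y ∈ K, F y t = 0)
    simp only [ht]
  · obtain ⟨x, hx, hxz⟩ := exists_measurable_zero (α := NullMeasurableSpace α μ) hK hG hGc hG0
    refine ⟨x, NullMeasurable.aemeasurable hx, ?_⟩
    filter_upwards [hGF] with t ht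
    have := hxz t
    simpa only [ht] using this

/-! ### Measurability of superpositions and derivatives -/

/-- Superposition: a Carathéodory function composed with a measurable function. -/
theorem aemeasurable_superposition {α E F : Type*} [MeasurableSpace α] {μ : Measure α}
    [NormedAddCommGroup E] [MeasurableSpace E] [BorelSpace E] [SecondCountableTopology E]
    [NormedAddCommGroup F] [MeasurableSpace F] [BorelSpace F] [SecondCountableTopology F]
    {f : E → α → F} (hf : ∀ x, AEMeasurable (f x) μ) {w : α → E} (hw : AEMeasurable w μ)
    (hc : ∀ᵐ t ∂μ, ContinuousAt (fun x => f x t) (w t)) :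
    AEMeasurable (fun t => f (w t) t) μ := by
  classical
  obtain ⟨v, hv, hwv⟩ := hw
  have hsm := hv.stronglyMeasurable
  have hsimple : ∀ k, AEMeasurable (fun t => f (hsm.approx k t) t) μ := by
    intro k
    have : (fun t => f (hsm.approx k t) t) = fun t => ∑ x ∈ (hsm.approx k).range,
        (hsm.approx k ⁻¹' {x}).indicator (f x) t := by
      ext t
      rw [Finset.sum_eq_single (hsm.approx k t)]
      · simp
      · intro b _ hb
        exact Set.indicator_of_notMem (by simpa using hb.symm) _
      · intro h
        exact absurd ((hsm.approx k).mem_range_self t) h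
    rw [this]
    exact Finset.aemeasurable_fun_sum _ fun x _ =>
      (hf x).indicator ((hsm.approx k).measurableSet_fiber x)
  refine aemeasurable_of_tendsto_metrizable_ae atTop hsimple ?_
  filter_upwards [hc, hwv] with t ht hvt
  rw [hvt] at ht ⊢
  exact ht.tendsto.comp (hsm.tendsto_approx t)

/-- The derivative of a Carathéodory function in a fixed direction is measurable. -/
theorem aemeasurable_fderiv_apply {α E F : Type*} [MeasurableSpace α] {μ : Measure α}
    [NormedAddCommGroup E] [NormedSpace ℝ E]
    [NormedAddCommGroup F] [NormedSpace ℝ F] [MeasurableSpace F] [BorelSpace F]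
    [SecondCountableTopology F]
    {f : E → α → F} {U : Set E} (hU : IsOpen U) (hf : ∀ x ∈ U, AEMeasurable (f x) μ)
    {x : E} (hx : x ∈ U) (hd : ∀ᵐ t ∂μ, DifferentiableAt ℝ (fun y => f y t) x) (v : E) :
    AEMeasurable (fun t => fderiv ℝ (fun y => f y t) x v) μ := by
  have hev : ∀ᶠ k : ℕ in atTop, x + (1 / ((k : ℝ) + 1)) • v ∈ U := by
    have : Tendsto (fun k : ℕ => x + (1 / ((k : ℝ) + 1)) • v) atTop (𝓝 (x + (0 : ℝ) • v)) :=
      tendsto_const_nhds.add (tendsto_one_div_add_atTop_nhds_zero_nat.smul_const v)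
    rw [zero_smul, add_zero] at this
    exact this (hU.mem_nhds hx)
  -- Difference quotients start at index `k₀`, so that all their points lie in `U`, where `f` is
  -- known to be measurable.
  obtain ⟨k₀, hk₀⟩ := eventually_atTop.1 hev
  refine aemeasurable_of_tendsto_metrizable_ae (f := fun (k : ℕ) t =>
    (((k + k₀ : ℕ) : ℝ) + 1) • (f (x + (1 / (((k + k₀ : ℕ) : ℝ) + 1)) • v) t - f x t)) atTop
    (fun k => ((hf _ (hk₀ _ (Nat.le_add_left _ _))).sub (hf x hx)).const_smul _) ?_
  filter_upwards [hd] with t ht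
  have hc : Tendsto (fun k : ℕ => ‖((k + k₀ : ℕ) : ℝ) + 1‖) atTop atTop :=
    tendsto_norm_atTop_atTop.comp <| tendsto_atTop_add_const_right _ _ <|
      tendsto_natCast_atTop_atTop.comp <| tendsto_add_atTop_nat k₀
  simpa only [one_div] using ht.hasFDerivAt.lim v hc

/-! ### Second-order expansion and curves in level sets -/

/-- Mean value inequality on `[0,1]` for `s ↦ f (x + s v) - s²/2 ⟨v, H v⟩`, whose derivative is the
inner product of `v` with the error in the linear approximation of the gradient. -/
theorem norm_taylor_two_le {E : Type*} [NormedAddCommGroup E] [InnerProductSpace ℝ E]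
    [CompleteSpace E] {f : E → ℝ} {x v : E} {H : E →L[ℝ] E} {c : ℝ}
    (hd : ∀ s ∈ Set.Icc (0 : ℝ) 1, DifferentiableAt ℝ f (x + s • v))
    (hg : ∀ s ∈ Set.Icc (0 : ℝ) 1, ‖gradient f (x + s • v) - s • H v‖ ≤ c * ‖v‖) :
    |f (x + v) - f x - 1 / 2 * inner ℝ v (H v)| ≤ c * ‖v‖ ^ 2 := by
  let g : ℝ → ℝ := fun s => f (x + s • v) - s ^ 2 / 2 * inner ℝ v (H v)
  have hgd : ∀ s ∈ Set.Icc (0 : ℝ) 1, HasDerivWithinAt g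
      (inner ℝ (gradient f (x + s • v) - s • H v) v) (Set.Icc 0 1) s := by
    intro s hs
    have h1 : HasDerivAt (fun s : ℝ => x + s • v) v s := by
      simpa using ((hasDerivAt_id s).smul_const v).const_add x
    have h2 := (hd s hs).hasGradientAt.hasFDerivAt.comp_hasDerivAt s h1
    have h3 : HasDerivAt (fun s : ℝ => s ^ 2 / 2 * inner ℝ v (H v)) (s * inner ℝ v (H v)) s := by
      refine (((hasDerivAt_pow 2 s).div_const 2).mul_const (inner ℝ v (H v))).congr_deriv ?_
      push_cast
      ring
    refine HasDerivAt.hasDerivWithinAt ?_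
    refine (h2.sub h3).congr_deriv ?_
    rw [inner_sub_left, inner_smul_left, real_inner_comm v (H v)]
    simp
  have hb : ∀ s ∈ Set.Icc (0 : ℝ) 1,
      ‖inner ℝ (gradient f (x + s • v) - s • H v) v‖ ≤ c * ‖v‖ ^ 2 := fun s hs => by
    refine (norm_inner_le_norm _ _).trans ?_
    have := mul_le_mul_of_nonneg_right (hg s hs) (norm_nonneg v)
    linarith [this, sq ‖v‖, mul_assoc c ‖v‖ ‖v‖, congrArg (c * ·) (sq ‖v‖)]
  have := (convex_Icc (0 : ℝ) 1).norm_image_sub_le_of_norm_hasDerivWithin_le hgd hb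
    (Set.left_mem_Icc.2 zero_le_one) (Set.right_mem_Icc.2 zero_le_one)
  simp only [g, Real.norm_eq_abs] at this
  norm_num at this
  convert this using 2
  ring

/-- Second-order Taylor expansion at a critical point. -/
theorem taylor_two_isLittleO {E : Type*} [NormedAddCommGroup E] [InnerProductSpace ℝ E]
    [CompleteSpace E] {f : E → ℝ} {x : E} {H : E →L[ℝ] E}
    (hd : ∀ᶠ y in 𝓝 x, DifferentiableAt ℝ f y) (hg : HasFDerivAt (gradient f) H x)
    (h0 : gradient f x = 0) :
    (fun v => f (x + v) - f x - 1 / 2 * inner ℝ v (H v)) =o[𝓝 0] fun v => ‖v‖ ^ 2 := by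
  rw [Asymptotics.isLittleO_iff]
  intro c hc
  have h1 := (hasFDerivAt_iff_isLittleO_nhds_zero.1 hg).def hc
  have h2 : ∀ᶠ v in 𝓝 (0 : E), DifferentiableAt ℝ f (x + v) := by
    have : Tendsto (fun v => x + v) (𝓝 0) (𝓝 x) := by
      simpa using (continuous_const.add continuous_id).tendsto (0 : E) (f := fun v => x + v)
    exact this.eventually hd
  obtain ⟨δ, hδ, hball⟩ := Metric.eventually_nhds_iff_ball.1 (h1.and h2)
  filter_upwards [Metric.ball_mem_nhds (0 : E) hδ] with v hv
  have hs : ∀ s ∈ Set.Icc (0 : ℝ) 1, s • v ∈ Metric.ball (0 : E) δ ∧ ‖s • v‖ ≤ ‖v‖ := by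
    intro s hs
    have : ‖s • v‖ ≤ ‖v‖ := by
      rw [norm_smul, Real.norm_of_nonneg hs.1]
      exact mul_le_of_le_one_left (norm_nonneg v) hs.2
    exact ⟨by rw [mem_ball_zero_iff] at *; linarith, this⟩
  rw [Real.norm_eq_abs, norm_pow, norm_norm]
  refine norm_taylor_two_le (fun s h => (hball _ (hs s h).1).2) fun s h => ?_
  have h3 := (hball _ (hs s h).1).1
  rw [h0, sub_zero, map_smul] at h3
  exact h3.trans (mul_le_mul_of_nonneg_left (hs s h).2 hc.le)

/-- If `f` does not exceed its value at a critical point along a curve with tangent `γ`, then the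
second derivative in direction `γ` is nonpositive. -/
theorem inner_hessian_nonpos_of_curve {E : Type*} [NormedAddCommGroup E] [InnerProductSpace ℝ E]
    [CompleteSpace E] {f : E → ℝ} {x γ : E} {H : E →L[ℝ] E}
    (hd : ∀ᶠ y in 𝓝 x, DifferentiableAt ℝ f y) (hg : HasFDerivAt (gradient f) H x)
    (h0 : gradient f x = 0) {c : ℝ → E} (hc0 : c 0 = x) (hc : HasDerivAt c γ 0)
    (hle : ∀ᶠ s in 𝓝 0, f (c s) ≤ f x) : inner ℝ γ (H γ) ≤ 0 := by
  have hw : Tendsto (fun s => c s - x) (𝓝[≠] 0) (𝓝 0) := by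
    have := hc.continuousAt.tendsto.sub_const x
    rw [hc0, sub_self] at this
    exact this.mono_left nhdsWithin_le_nhds
  have hq : Tendsto (fun s : ℝ => s⁻¹ • (c s - x)) (𝓝[≠] 0) (𝓝 γ) := by
    have := hasDerivAt_iff_tendsto_slope_zero.1 hc
    simpa [hc0] using this
  have hrem : Tendsto (fun s : ℝ => (s ^ 2)⁻¹ *
      (f (x + (c s - x)) - f x - 1 / 2 * inner ℝ (c s - x) (H (c s - x)))) (𝓝[≠] 0) (𝓝 0) := by
    have h1 := (taylor_two_isLittleO hd hg h0).comp_tendsto hw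
    have h2 : (fun s : ℝ => ‖c s - x‖ ^ 2) =O[𝓝[≠] 0] fun s => s ^ 2 := by
      have h3 : (fun s => c s - x) =O[𝓝 0] fun s : ℝ => s := by
        simpa [hc0] using hc.isBigO_sub
      exact (h3.norm_left.pow 2).mono nhdsWithin_le_nhds
    have h4 := (h1.trans_isBigO h2).tendsto_div_nhds_zero
    refine h4.congr fun s => ?_
    simp [div_eq_inv_mul]
  have hquad : Tendsto (fun s : ℝ => inner ℝ (s⁻¹ • (c s - x)) (H (s⁻¹ • (c s - x)))) (𝓝[≠] 0)
      (𝓝 (inner ℝ γ (H γ))) := hq.inner ((H.continuous.tendsto γ).comp hq)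
  have hsum := (hrem.add (hquad.const_mul (1 / 2)))
  rw [zero_add] at hsum
  -- Adding remainder and quadratic term leaves `(f (c s) - f x) / s²`, which is nonpositive near 0
  -- and tends to half the quadratic form at `γ`.
  have : 1 / 2 * inner ℝ γ (H γ) ≤ 0 := by
    refine le_of_tendsto hsum ?_
    filter_upwards [hle.filter_mono nhdsWithin_le_nhds, self_mem_nhdsWithin] with s hs hs0
    have hs0 : s ≠ 0 := hs0
    rw [map_smul, inner_smul_left, inner_smul_right]
    simp only [RCLike.conj_to_real, add_sub_cancel]
    have h2 : (s ^ 2)⁻¹ * (f (c s) - f x) ≤ 0 :=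
      mul_nonpos_of_nonneg_of_nonpos (by positivity) (by linarith)
    calc _ = (s ^ 2)⁻¹ * (f (c s) - f x) := by ring
      _ ≤ 0 := h2
  linarith

/-- A direction in the kernel of a surjective derivative is tangent to a curve in the level set. -/
theorem exists_curve_of_mem_ker {E F : Type*} [NormedAddCommGroup E] [NormedSpace ℝ E]
    [CompleteSpace E] [NormedAddCommGroup F] [NormedSpace ℝ F] [FiniteDimensional ℝ F]
    {g : E → F} {A : E →L[ℝ] F} {x γ : E} (hg : HasStrictFDerivAt g A x)
    (hA : A.range = ⊤) (hγ : A γ = 0) :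
    ∃ c : ℝ → E, c 0 = x ∧ HasDerivAt c γ 0 ∧ ∀ᶠ s in 𝓝 0, g (c s) = g x := by
  have := FiniteDimensional.complete ℝ F
  let k : A.ker := ⟨γ, hγ⟩
  -- The implicit function parametrizes the level set by the kernel of `A`, and its derivative at 0
  -- is the inclusion of that kernel.
  refine ⟨fun s => hg.implicitFunction g A hA (g x) (s • k), ?_, ?_, ?_⟩
  · simp
  · have h1 := (hg.to_implicitFunction hA).hasFDerivAt
    have h2 : HasDerivAt (fun s : ℝ => s • k) k 0 := by
      simpa using (hasDerivAt_id (0 : ℝ)).smul_const k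
    have h3 := HasFDerivAt.comp_hasDerivAt (0 : ℝ) (by simpa using h1) h2
    exact h3
  · have h1 := hg.map_implicitFunction_eq hA
    have h2 : Tendsto (fun s : ℝ => (g x, s • k)) (𝓝 0) (𝓝 (g x, 0)) := by
      have : Continuous fun s : ℝ => (g x, s • k) := by fun_prop
      simpa using this.tendsto 0
    exact h2.eventually h1

/-! ### Multiplier rules in finite dimensions -/

theorem isUnit_comp_adjoint_of_gramDet_ne_zero {n p : ℕ} {A : Vec n →L[ℝ] Vec p}
    (hA : gramDet A ≠ 0) : IsUnit (A ∘L ContinuousLinearMap.adjoint A) := by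
  rw [ContinuousLinearMap.isUnit_iff_isUnit_toLinearMap, LinearMap.isUnit_iff_isUnit_det]
  exact isUnit_iff_ne_zero.2 hA

theorem range_eq_top_of_gramDet_ne_zero {n p : ℕ} {A : Vec n →L[ℝ] Vec p}
    (hA : gramDet A ≠ 0) : A.range = ⊤ := by
  rw [LinearMap.range_eq_top]
  intro y
  have := (ContinuousLinearMap.isUnit_iff_bijective.1
    (isUnit_comp_adjoint_of_gramDet_ne_zero hA)).2 y
  obtain ⟨x, hx⟩ := this
  exact ⟨_, hx⟩

/-- The Lagrange multiplier `-(A A')⁻¹ A g` solving `g + A' u = 0`. -/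
def multiplier {n p : ℕ} (A : Vec n →L[ℝ] Vec p) (g : Vec n) : Vec p :=
  -(Ring.inverse (A ∘L ContinuousLinearMap.adjoint A) (A g))

/-- Applying `A` to the equation gives `A g = -(A A') u`, and `A A'` is invertible. -/
theorem eq_multiplier {n p : ℕ} {A : Vec n →L[ℝ] Vec p} (hA : gramDet A ≠ 0) {g : Vec n}
    {u : Vec p} (h : g + ContinuousLinearMap.adjoint A u = 0) : u = multiplier A g := by
  have h1 : A g = -((A ∘L ContinuousLinearMap.adjoint A) u) := by
    rw [eq_neg_of_add_eq_zero_left h, map_neg]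
    rfl
  have h2 := Ring.inverse_mul_cancel _ (isUnit_comp_adjoint_of_gramDet_ne_zero hA)
  rw [multiplier, h1, map_neg, neg_neg, ← mul_apply_eq_comp, h2]
  rfl

theorem hasFDerivAt_coord {n p : ℕ} {c : Vec n → Vec p} {x : Vec n}
    (hc : DifferentiableAt ℝ c x) (i : Fin p) :
    HasFDerivAt (fun y => c y i) ((EuclideanSpace.proj i : Vec p →L[ℝ] ℝ) ∘L jacobian c x) x :=
  (EuclideanSpace.proj i : Vec p →L[ℝ] ℝ).hasFDerivAt.comp x hc.hasFDerivAt

theorem inner_gradient_eq_fderiv {n : ℕ} (f : Vec n → ℝ) (x v : Vec n) :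
    inner ℝ (gradient f x) v = fderiv ℝ f x v := by
  rw [gradient, InnerProductSpace.toDual_symm_apply]

/-- Passes between the coordinate form of the stationarity condition and `g + A' u = 0`. -/
theorem sum_smul_gradient_coord {n p : ℕ} {c : Vec n → Vec p} {x : Vec n}
    (hc : DifferentiableAt ℝ c x) (u : Vec p) :
    ∑ i, u i • gradient (fun y => c y i) x = ContinuousLinearMap.adjoint (jacobian c x) u := by
  refine ext_inner_right ℝ fun v => ?_
  rw [sum_inner, ContinuousLinearMap.adjoint_inner_left, PiLp.inner_apply]
  refine Finset.sum_congr rfl fun i _ => ?_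
  rw [inner_smul_left, inner_gradient_eq_fderiv, (hasFDerivAt_coord hc i).fderiv]
  simp [mul_comm]

/-- Lagrange multiplier rule in finite dimensions. -/
theorem exists_multiplier_of_isLocalMaxOn {n p : ℕ} {f : Vec n → ℝ} {c : Vec n → Vec p} {x : Vec n}
    (hf : ContDiffAt ℝ 2 f x) (hc : ContDiffAt ℝ 2 c x) (hA : gramDet (jacobian c x) ≠ 0)
    (hmax : IsLocalMaxOn f {y | c y = c x} x) :
    ∃ u : Vec p, gradient f x + ContinuousLinearMap.adjoint (jacobian c x) u = 0 := by
  have hfs := hf.hasStrictFDerivAt (by norm_num)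
  have hcs := hc.hasStrictFDerivAt (by norm_num)
  have hextr : IsLocalExtrOn f {y | c y = c x} x := Or.inr hmax
  obtain ⟨Λ, Λ₀, hne, hΛ⟩ := hextr.exists_linear_map_of_hasStrictFDerivAt hcs hfs
  have hsurj := LinearMap.range_eq_top.1 (range_eq_top_of_gramDet_ne_zero hA)
  -- If `Λ₀ = 0`, then `Λ` vanishes on the range of the Jacobian, which is everything, so both
  -- multipliers would be 0.
  have hΛ₀ : Λ₀ ≠ 0 := by
    rintro rfl
    refine hne (Prod.ext (LinearMap.ext fun y => ?_) rfl)
    obtain ⟨v, rfl⟩ := hsurj y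
    simpa [jacobian] using hΛ v
  refine ⟨Λ₀⁻¹ • (InnerProductSpace.toDual ℝ (Vec p)).symm (LinearMap.toContinuousLinearMap Λ),
    ext_inner_right ℝ fun v => ?_⟩
  rw [inner_add_left, inner_gradient_eq_fderiv, ContinuousLinearMap.adjoint_inner_left,
    inner_smul_left, InnerProductSpace.toDual_symm_apply, inner_zero_left]
  have h1 := hΛ v
  change fderiv ℝ f x v + Λ₀⁻¹ * Λ (fderiv ℝ c x v) = 0
  rw [smul_eq_mul] at h1
  rw [eq_neg_of_add_eq_zero_left h1]
  field_simp
  ring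

theorem differentiableAt_gradient {n : ℕ} {f : Vec n → ℝ} {x : Vec n} (hf : ContDiffAt ℝ 2 f x) :
    DifferentiableAt ℝ (gradient f) x :=
  ((InnerProductSpace.toDual ℝ (Vec n)).symm.toContinuousLinearEquiv.differentiableAt).comp x
    ((hf.fderiv_right (m := 1) (by norm_num)).differentiableAt (by norm_num))

/-- Second-order necessary condition in finite dimensions. -/
theorem inner_hessian_nonpos_of_isLocalMaxOn {n p : ℕ} {f : Vec n → ℝ} {c : Vec n → Vec p}
    {x : Vec n} (hf : ContDiffAt ℝ 2 f x) (hc : ContDiffAt ℝ 2 c x)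
    (hA : gramDet (jacobian c x) ≠ 0) (hmax : IsLocalMaxOn f {y | c y = c x} x) {u : Vec p}
    (hu : gradient f x + ∑ i, u i • gradient (fun y => c y i) x = 0) {γ : Vec n}
    (hγ : jacobian c x γ = 0) :
    inner ℝ γ ((hessian f x + ∑ i, u i • hessian (fun y => c y i) x) γ) ≤ 0 := by
  have hci : ∀ i, ContDiffAt ℝ 2 (fun y => c y i) x := fun i => contDiffAt_euclidean.1 hc i
  have hev : ∀ {g : Vec n → ℝ}, ContDiffAt ℝ 2 g x → ∀ᶠ y in 𝓝 x, DifferentiableAt ℝ g y :=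
    fun hg => (hg.eventually (by norm_num)).mono fun y hy => hy.differentiableAt (by norm_num)
  have hevi : ∀ᶠ y in 𝓝 x, ∀ i, DifferentiableAt ℝ (fun y => c y i) y :=
    eventually_all.2 fun i => hev (hci i)
  -- The Lagrangian differs from `f` by a constant on the level set, and `x` is a critical point of
  -- it, so `inner_hessian_nonpos_of_curve` applies to `L`.
  let L : Vec n → ℝ := fun y => f y + ∑ i, u i * c y i
  have hgrad : ∀ᶠ y in 𝓝 x, HasGradientAt L
      (gradient f y + ∑ i, u i • gradient (fun y => c y i) y) y := by
    filter_upwards [hev hf, hevi] with y h1 h2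
    rw [hasGradientAt_iff_hasFDerivAt, map_add, map_sum]
    refine h1.hasGradientAt.hasFDerivAt.add (HasFDerivAt.fun_sum fun i _ => ?_)
    rw [map_smul]
    exact (h2 i).hasGradientAt.hasFDerivAt.const_mul (u i)
  have heq : gradient L =ᶠ[𝓝 x] fun y => gradient f y + ∑ i, u i • gradient (fun y => c y i) y :=
    hgrad.mono fun y hy => hy.gradient
  have hH : HasFDerivAt (gradient L) (hessian f x + ∑ i, u i • hessian (fun y => c y i) x) x := by
    refine HasFDerivAt.congr_of_eventuallyEq ?_ heq
    exact (differentiableAt_gradient hf).hasFDerivAt.add (HasFDerivAt.fun_sum fun i _ =>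
      (differentiableAt_gradient (hci i)).hasFDerivAt.const_smul (u i))
  obtain ⟨k, hk0, hk, hkc⟩ := exists_curve_of_mem_ker (hc.hasStrictFDerivAt (by norm_num))
    (range_eq_top_of_gramDet_ne_zero hA) hγ
  refine inner_hessian_nonpos_of_curve (hgrad.mono fun y hy => hy.differentiableAt) hH
    (heq.self_of_nhds.trans hu) hk0 hk ?_
  have htend : Tendsto k (𝓝 0) (𝓝 x) := hk0 ▸ hk.continuousAt.tendsto
  filter_upwards [hkc, htend.eventually (eventually_nhdsWithin_iff.1 hmax)] with s h1 h2
  simp only [L, h1]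
  exact add_le_add_left (h2 h1) _

/-! ### Measurability along a trajectory -/

/-- Recentring at `w t` replaces the moving ball of regularity by the fixed ball around 0, on which
difference quotients in `y` can be formed for almost every `t` at once. -/
theorem aemeasurable_shift {α E F : Type*} [MeasurableSpace α] {μ : Measure α}
    [NormedAddCommGroup E] [MeasurableSpace E] [BorelSpace E] [SecondCountableTopology E]
    [NormedAddCommGroup F] [MeasurableSpace F] [BorelSpace F] [SecondCountableTopology F]
    {f : E → α → F} (hf : ∀ x, AEMeasurable (f x) μ) {w : α → E} (hw : AEMeasurable w μ) {ε : ℝ}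
    (hc : ∀ᵐ t ∂μ, ∀ x ∈ Metric.ball (w t) ε, ContinuousAt (fun x => f x t) x) {y : E}
    (hy : y ∈ Metric.ball 0 ε) : AEMeasurable (fun t => f (w t + y) t) μ := by
  refine aemeasurable_superposition hf (hw.add_const y) ?_
  filter_upwards [hc] with t ht
  exact ht _ (by simpa using hy)

/-- Directional derivatives near a measurable trajectory are measurable. -/
theorem aemeasurable_fderiv_shift {α E F : Type*} [MeasurableSpace α] {μ : Measure α}
    [NormedAddCommGroup E] [NormedSpace ℝ E] [MeasurableSpace E] [BorelSpace E]
    [SecondCountableTopology E] [NormedAddCommGroup F] [NormedSpace ℝ F] [MeasurableSpace F]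
    [BorelSpace F] [SecondCountableTopology F]
    {f : E → α → F} (hf : ∀ x, AEMeasurable (f x) μ) {w : α → E} (hw : AEMeasurable w μ) {ε : ℝ}
    (hd : ∀ᵐ t ∂μ, ∀ x ∈ Metric.ball (w t) ε, DifferentiableAt ℝ (fun x => f x t) x) {y : E}
    (hy : y ∈ Metric.ball 0 ε) (v : E) :
    AEMeasurable (fun t => fderiv ℝ (fun x => f x t) (w t + y) v) μ := by
  have h1 := aemeasurable_fderiv_apply (f := fun x t => f (w t + x) t) (μ := μ)
    Metric.isOpen_ball (fun x hx => aemeasurable_shift hf hw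
      (hd.mono fun t ht x hx => (ht x hx).continuousAt) hx) hy
    (hd.mono fun t ht => by
      have := ht (w t + y) (by simpa using hy)
      exact (differentiableAt_comp_add_left (w t)).2 this) v
  refine h1.congr (ae_of_all _ fun t => ?_)
  exact congrArg (· v) (fderiv_comp_add_left (𝕜 := ℝ) (f := fun x => f x t) (w t))

theorem gradient_eq_sum {n : ℕ} (f : Vec n → ℝ) (x : Vec n) :
    gradient f x = ∑ i, fderiv ℝ f x (EuclideanSpace.basisFun (Fin n) ℝ i) •
      EuclideanSpace.basisFun (Fin n) ℝ i := by
  conv_lhs => rw [← (EuclideanSpace.basisFun (Fin n) ℝ).sum_repr' (gradient f x)]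
  refine Finset.sum_congr rfl fun i _ => ?_
  rw [real_inner_comm, inner_gradient_eq_fderiv]

theorem aemeasurable_gradient_shift {α : Type*} [MeasurableSpace α] {μ : Measure α} {n : ℕ}
    {f : Vec n → α → ℝ} (hf : ∀ x, AEMeasurable (f x) μ) {w : α → Vec n} (hw : AEMeasurable w μ)
    {ε : ℝ} (hd : ∀ᵐ t ∂μ, ∀ x ∈ Metric.ball (w t) ε, DifferentiableAt ℝ (fun x => f x t) x)
    {y : Vec n} (hy : y ∈ Metric.ball 0 ε) :
    AEMeasurable (fun t => gradient (fun x => f x t) (w t + y)) μ := by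
  simp only [gradient_eq_sum]
  exact Finset.aemeasurable_fun_sum _ fun i _ =>
    (aemeasurable_fderiv_shift hf hw hd hy _).smul_const _

theorem aemeasurable_gradient {α : Type*} [MeasurableSpace α] {μ : Measure α} {n : ℕ}
    {f : Vec n → α → ℝ} (hf : ∀ x, AEMeasurable (f x) μ) {w : α → Vec n} (hw : AEMeasurable w μ)
    {ε : ℝ} (hε : 0 < ε)
    (hd : ∀ᵐ t ∂μ, ∀ x ∈ Metric.ball (w t) ε, DifferentiableAt ℝ (fun x => f x t) x) :
    AEMeasurable (fun t => gradient (fun x => f x t) (w t)) μ := by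
  simpa using aemeasurable_gradient_shift hf hw hd (Metric.mem_ball_self hε)

/-- For a fixed direction the Hessian is a limit of difference quotients of the recentred gradient;
a superposition then inserts the measurable direction `γ`. -/
theorem aemeasurable_hessian_apply {α : Type*} [MeasurableSpace α] {μ : Measure α} {n : ℕ}
    {f : Vec n → α → ℝ} (hf : ∀ x, AEMeasurable (f x) μ) {w : α → Vec n} (hw : AEMeasurable w μ)
    {ε : ℝ} (hε : 0 < ε)
    (hd : ∀ᵐ t ∂μ, ∀ x ∈ Metric.ball (w t) ε, ContDiffAt ℝ 2 (fun x => f x t) x)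
    {γ : α → Vec n} (hγ : AEMeasurable γ μ) :
    AEMeasurable (fun t => hessian (fun x => f x t) (w t) (γ t)) μ := by
  refine aemeasurable_superposition (f := fun x t => hessian (fun x => f x t) (w t) x)
    (fun v => ?_) hγ (ae_of_all _ fun t => (ContinuousLinearMap.continuous _).continuousAt)
  have hd1 : ∀ᵐ t ∂μ, ∀ x ∈ Metric.ball (w t) ε, DifferentiableAt ℝ (fun x => f x t) x :=
    hd.mono fun t ht x hx => (ht x hx).differentiableAt (by norm_num)
  have h1 := aemeasurable_fderiv_apply (μ := μ)
    (f := fun x t => gradient (fun x => f x t) (w t + x)) Metric.isOpen_ball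
    (fun x hx => aemeasurable_gradient_shift hf hw hd1 hx) (Metric.mem_ball_self hε)
    (hd.mono fun t ht => by
      have := differentiableAt_gradient (ht (w t) (Metric.mem_ball_self hε))
      refine (differentiableAt_comp_add_left (w t)).2 ?_
      rwa [add_zero]) v
  refine h1.congr (ae_of_all _ fun t => ?_)
  have h2 := fderiv_comp_add_left (𝕜 := ℝ) (f := gradient fun z => f z t) (x := 0) (w t)
  rw [add_zero] at h2
  exact congrArg (· v) h2

/-- `A t` is a finite sum of rank-one maps built from its values on the standard basis. -/
theorem aemeasurable_clm {α F : Type*} [MeasurableSpace α] {μ : Measure α} {n : ℕ}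
    [NormedAddCommGroup F] [NormedSpace ℝ F] [FiniteDimensional ℝ F] [MeasurableSpace F]
    [BorelSpace F] {A : α → Vec n →L[ℝ] F} (hA : ∀ v, AEMeasurable (fun t => A t v) μ) :
    AEMeasurable A μ := by
  have : FiniteDimensional ℝ (Vec n →L[ℝ] F) := inferInstance
  have : SecondCountableTopology (Vec n →L[ℝ] F) := secondCountable_of_proper
  have h1 : A = fun t => ∑ i, (EuclideanSpace.proj i : Vec n →L[ℝ] ℝ).smulRight
      (A t (EuclideanSpace.basisFun (Fin n) ℝ i)) := by
    ext t v
    conv_lhs => rw [← (EuclideanSpace.basisFun (Fin n) ℝ).sum_repr v]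
    simp
  rw [h1]
  refine Finset.aemeasurable_fun_sum _ fun i _ => ?_
  have h2 : Continuous fun y : F => (EuclideanSpace.proj i : Vec n →L[ℝ] ℝ).smulRight y :=
    (ContinuousLinearMap.smulRightL ℝ (Vec n) F (EuclideanSpace.proj i)).continuous
  exact h2.measurable.comp_aemeasurable (hA _)

/-! ### Essential boundedness of the multiplier -/

theorem continuous_gramDet {n p : ℕ} : Continuous (gramDet : (Vec n →L[ℝ] Vec p) → ℝ) := by
  refine ContinuousLinearMap.continuous_det.comp ?_
  exact continuous_id.clm_comp ContinuousLinearMap.adjoint.continuous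

/-- The pairs (Jacobian, gradient) obeying uniform bounds. -/
def boundedPairs (n p : ℕ) (K₀ K Kφ : ℝ) : Set ((Vec n →L[ℝ] Vec p) × Vec n) :=
  {q | ‖q.1‖ ≤ K₀ ∧ K ≤ gramDet q.1 ∧ ‖q.2‖ ≤ Kφ}

theorem isCompact_boundedPairs (n p : ℕ) (K₀ K Kφ : ℝ) : IsCompact (boundedPairs n p K₀ K Kφ) := by
  refine Metric.isCompact_of_isClosed_isBounded ?_ ?_
  · exact (isClosed_le continuous_fst.norm continuous_const).inter
      ((isClosed_le continuous_const (continuous_gramDet.comp continuous_fst)).inter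
        (isClosed_le continuous_snd.norm continuous_const))
  · refine (Metric.isBounded_closedBall (x := 0) (r := max K₀ Kφ)).subset fun q hq => ?_
    rw [mem_closedBall_zero_iff, Prod.norm_def]
    exact max_le_max hq.1 hq.2.2

/-- The bound `0 < K ≤ gramDet` makes `A A'` a unit, and inversion is continuous at units. -/
theorem continuousOn_multiplier {n p : ℕ} {K₀ K Kφ : ℝ} (hK : 0 < K) :
    ContinuousOn (fun q : (Vec n →L[ℝ] Vec p) × Vec n => multiplier q.1 q.2)
      (boundedPairs n p K₀ K Kφ) := by
  intro q hq
  refine ContinuousAt.continuousWithinAt ?_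
  obtain ⟨e, he⟩ := isUnit_comp_adjoint_of_gramDet_ne_zero (hK.trans_le hq.2.1).ne'
  have h1 : Continuous fun q : (Vec n →L[ℝ] Vec p) × Vec n =>
      q.1 ∘L ContinuousLinearMap.adjoint q.1 :=
    continuous_fst.clm_comp (ContinuousLinearMap.adjoint.continuous.comp continuous_fst)
  have h2 : ContinuousAt (fun q : (Vec n →L[ℝ] Vec p) × Vec n =>
      Ring.inverse (q.1 ∘L ContinuousLinearMap.adjoint q.1)) q :=
    ContinuousAt.comp (g := Ring.inverse) (by rw [← he]; exact NormedRing.inverse_continuousAt e)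
      h1.continuousAt
  exact (h2.clm_apply (continuous_fst.clm_apply continuous_snd).continuousAt).neg

/-- A continuous function on a compact set, composed with a measurable function, is essentially
bounded. -/
theorem memLp_top_comp_of_continuousOn {α X F : Type*} [MeasurableSpace α] {μ : Measure α}
    [TopologicalSpace X] [T2Space X] [MeasurableSpace X] [OpensMeasurableSpace X]
    [NormedAddCommGroup F] [SecondCountableTopology F] [MeasurableSpace F] [BorelSpace F]
    {S : Set X} (hS : IsCompact S) {f : X → F} (hf : ContinuousOn f S) {q : α → X}
    (hq : AEMeasurable q μ) (hqS : ∀ᵐ t ∂μ, q t ∈ S) : MemLp (fun t => f (q t)) ∞ μ := by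
  classical
  obtain ⟨C, hC⟩ := hS.exists_bound_of_continuousOn hf
  -- Extension by 0 off `S` gives a globally measurable function.
  have hmeas := hf.measurable_piecewise (g := fun _ => 0) continuousOn_const hS.measurableSet
  have h1 : AEMeasurable (fun t => f (q t)) μ := by
    refine (hmeas.comp_aemeasurable hq).congr ?_
    filter_upwards [hqS] with t ht
    exact Set.piecewise_eq_of_mem _ _ _ ht
  exact memLp_top_of_bound h1.aestronglyMeasurable C (hqS.mono fun t ht => hC _ ht)

theorem memLp_multiplier {α : Type*} [MeasurableSpace α] {μ : Measure α} {n p : ℕ}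
    {q : α → (Vec n →L[ℝ] Vec p) × Vec n} {K₀ K Kφ : ℝ} (hK : 0 < K)
    (hq : AEMeasurable q μ)
    (hb : ∀ᵐ t ∂μ, q t ∈ boundedPairs n p K₀ K Kφ) :
    MemLp (fun t => multiplier (q t).1 (q t).2) ∞ μ := by
  have : SecondCountableTopology (Vec n →L[ℝ] Vec p) := secondCountable_of_proper
  have hf := continuousOn_multiplier (n := n) (p := p) (K₀ := K₀) (Kφ := Kφ) hK
  exact memLp_top_comp_of_continuousOn (isCompact_boundedPairs n p K₀ K Kφ) hf hq hb

/-! ### From the functional to the pointwise problem -/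

theorem norm_toLp_top_le {α E : Type*} [MeasurableSpace α] {μ : Measure α} [IsFiniteMeasure μ]
    [NormedAddCommGroup E] {f : α → E} (hf : MemLp f ∞ μ) {r : ℝ} (hr : 0 ≤ r)
    (hb : ∀ᵐ t ∂μ, ‖f t‖ ≤ r) : ‖hf.toLp f‖ ≤ r := by
  have := Lp.norm_le_of_ae_bound (f := hf.toLp f) hr (by
    filter_upwards [hb, hf.coeFn_toLp] with t h1 h2
    rwa [h2])
  simpa using this

theorem exists_le_of_measure_ne_zero {α : Type*} [MeasurableSpace α] {μ : Measure α} {N : Set α}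
    (hN : μ N ≠ 0) (ψ : α → ℝ) : ∃ m : ℕ, μ (N ∩ {t | ‖ψ t‖ ≤ m}) ≠ 0 := by
  by_contra! h
  refine hN (measure_mono_null (fun t ht => ?_) (measure_iUnion_null h))
  obtain ⟨m, hm⟩ := exists_nat_ge ‖ψ t‖
  exact Set.mem_iUnion.2 ⟨m, ht, hm⟩

/-- A local solution admits no measurable feasible variation that improves the integrand by a
fixed amount on a set of positive measure. -/
theorem measure_eq_zero_of_improvement {T : ℝ} {n p : ℕ} {φ : Vec n → ℝ → ℝ}
    {h : Vec n → ℝ → Vec p} {zbar : LInf T n} (hfeas : zbar ∈ feasible T h)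
    (hfin : ObjectiveFinite φ zbar) {r : ℝ} (hr : 0 ≤ r)
    (hloc : ∀ z ∈ feasible T h, ‖z - zbar‖ ≤ r → ObjectiveFinite φ z →
      objective φ z ≤ objective φ zbar)
    {N : Set ℝ} (hN : NullMeasurableSet N (timeMeasure T)) {x : ℝ → Vec n}
    (hx : AEMeasurable x (timeMeasure T))
    (hφx : AEMeasurable (fun t => φ (zbar t + x t) t) (timeMeasure T)) {e : ℝ} (he : 0 < e)
    (himp : ∀ᵐ t ∂(timeMeasure T), t ∈ N → ‖x t‖ ≤ r ∧ h (zbar t + x t) t = 0 ∧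
      φ (zbar t) t + e ≤ φ (zbar t + x t) t) :
    timeMeasure T N = 0 := by
  classical
  by_contra hpos
  set μ := timeMeasure T
  have hfinm : IsFiniteMeasure μ := inferInstance
  set ψ : ℝ → ℝ := fun t => φ (zbar t + x t) t
  -- The improved integrand need not be integrable on `N`; restricting to where it is bounded by `m`
  -- makes the objective of the competitor finite.
  obtain ⟨m, hm⟩ := exists_le_of_measure_ne_zero hpos ψ
  have hB : NullMeasurableSet (N ∩ {t | ‖ψ t‖ ≤ m}) μ :=
    hN.inter (nullMeasurableSet_le hφx.norm aemeasurable_const)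
  obtain ⟨B, hBsub, hBm, hBeq⟩ := hB.exists_measurable_subset_ae_eq
  rw [← measure_congr hBeq] at hm
  have hxb : ∀ᵐ t ∂μ, ‖B.indicator x t‖ ≤ r := by
    filter_upwards [himp] with t ht
    by_cases htB : t ∈ B
    · rw [Set.indicator_of_mem htB]; exact (ht (hBsub htB).1).1
    · rw [Set.indicator_of_notMem htB]; simpa using hr
  have hmem : MemLp (B.indicator x) ∞ μ :=
    memLp_top_of_bound (hx.indicator hBm).aestronglyMeasurable r hxb
  let z : LInf T n := zbar + hmem.toLp _
  have hz : ∀ᵐ t ∂μ, z t = zbar t + B.indicator x t := by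
    filter_upwards [Lp.coeFn_add zbar (hmem.toLp _), hmem.coeFn_toLp] with t h1 h2
    rw [h1, Pi.add_apply, h2]
  have hzfeas : z ∈ feasible T h := by
    change ∀ᵐ t ∂μ, h (z t) t = 0
    filter_upwards [hz, himp, hfeas] with t h1 h2 h3
    rw [h1]
    by_cases htB : t ∈ B
    · rw [Set.indicator_of_mem htB]; exact (h2 (hBsub htB).1).2.1
    · rwa [Set.indicator_of_notMem htB, add_zero]
  have hznorm : ‖z - zbar‖ ≤ r := by
    rw [add_sub_cancel_left]
    exact norm_toLp_top_le hmem hr hxb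
  have hφz : (fun t => φ (z t) t) =ᵐ[μ]
      fun t => φ (zbar t) t + B.indicator (fun t => ψ t - φ (zbar t) t) t := by
    filter_upwards [hz] with t h1
    rw [h1]
    by_cases htB : t ∈ B
    · simp only [Set.indicator_of_mem htB, ψ]; ring
    · simp only [Set.indicator_of_notMem htB, add_zero]
  have hψint : IntegrableOn ψ B μ :=
    Measure.integrableOn_of_bounded (measure_ne_top μ B) hφx.aestronglyMeasurable
      ((ae_restrict_iff' hBm).2 (ae_of_all _ fun t ht => (hBsub ht).2))
  have hdint : Integrable (B.indicator fun t => ψ t - φ (zbar t) t) μ :=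
    (integrable_indicator_iff hBm).2 (hψint.sub hfin.integrableOn)
  have hzfin : ObjectiveFinite φ z := (hfin.add hdint).congr hφz.symm
  have hle := hloc z hzfeas hznorm hzfin
  have h1 : objective φ z = objective φ zbar + ∫ t, B.indicator (fun t => ψ t - φ (zbar t) t) t ∂μ :=
    (integral_congr_ae hφz).trans (integral_add hfin hdint)
  have h2 : ∫ t, B.indicator (fun _ => e) t ∂μ ≤
      ∫ t, B.indicator (fun t => ψ t - φ (zbar t) t) t ∂μ := by
    refine integral_mono_ae ((integrable_const e).indicator hBm) hdint ?_
    filter_upwards [himp] with t ht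
    by_cases htB : t ∈ B
    · simp only [Set.indicator_of_mem htB, ψ]
      linarith [(ht (hBsub htB).1).2.2]
    · simp only [Set.indicator_of_notMem htB, le_refl]
  rw [integral_indicator_const e hBm, smul_eq_mul] at h2
  have h3 : 0 < μ.real B := ENNReal.toReal_pos hm (measure_ne_top μ B)
  nlinarith [mul_pos h3 he]

/-- A local solution of the infinite-dimensional problem solves, at almost every time, the
finite-dimensional problem locally, with a radius independent of the time. -/
theorem ae_pointwise_local_solution {T : ℝ} {n p : ℕ} {φ : Vec n → ℝ → ℝ}
    {h : Vec n → ℝ → Vec p} {zbar : LInf T n} {ε : ℝ} (hε : 0 < ε)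
    (hopt : IsLocalSolution φ h zbar) (hφm : ∀ x, AEMeasurable (φ x) (timeMeasure T))
    (hφc : ∀ᵐ t ∂(timeMeasure T), Continuous fun x => φ x t)
    (hhm : ∀ x, AEMeasurable (h x) (timeMeasure T))
    (hhc : ∀ᵐ t ∂(timeMeasure T), ∀ x ∈ Metric.ball (zbar t) ε,
      ContinuousAt (fun x => h x t) x) :
    ∃ r : ℝ, 0 < r ∧ ∀ᵐ t ∂(timeMeasure T), ∀ y ∈ Metric.closedBall (zbar t) r,
      h y t = 0 → φ y t ≤ φ (zbar t) t := by
  obtain ⟨hfeas, hfin, ε₀, hε₀, hloc⟩ := hopt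
  have hzm : AEMeasurable (zbar : ℝ → Vec n) (timeMeasure T) :=
    (Lp.aestronglyMeasurable zbar).aemeasurable
  -- Competitors stay within the optimality radius and strictly inside the ball on which `h` is
  -- regular.
  let r := min ε₀ (ε / 2)
  have hr : 0 < r := lt_min hε₀ (half_pos hε)
  have hrε : Metric.closedBall (0 : Vec n) r ⊆ Metric.ball 0 ε :=
    Metric.closedBall_subset_ball ((min_le_right _ _).trans_lt (half_lt_self hε))
  refine ⟨r, hr, ?_⟩
  have hφc' : ∀ w : ℝ → Vec n, ∀ᵐ t ∂(timeMeasure T), ContinuousAt (fun x => φ x t) (w t) :=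
    fun w => hφc.mono fun t ht => ht.continuousAt
  -- The zeros of `F k · t` are exactly the displacements that are feasible and gain at least
  -- `1/(k+1)`.
  let F : ℕ → Vec n → ℝ → ℝ := fun k y t =>
    ‖h (zbar t + y) t‖ + max 0 (φ (zbar t) t + 1 / ((k : ℝ) + 1) - φ (zbar t + y) t)
  have hF0 : ∀ k y t, 0 ≤ F k y t := fun k y t => by positivity
  have hFzero : ∀ k y t, F k y t = 0 ↔
      h (zbar t + y) t = 0 ∧ φ (zbar t) t + 1 / ((k : ℝ) + 1) ≤ φ (zbar t + y) t := by
    intro k y t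
    rw [add_eq_zero_iff_of_nonneg (norm_nonneg _) (le_max_left _ _), norm_eq_zero, max_eq_left_iff,
      sub_nonpos]
  have hnull : ∀ k, timeMeasure T {t | ∃ y ∈ Metric.closedBall (0 : Vec n) r, F k y t = 0} = 0 := by
    intro k
    have hFm : ∀ y ∈ Metric.closedBall (0 : Vec n) r, AEMeasurable (F k y) (timeMeasure T) := by
      intro y hy
      have h1 := aemeasurable_shift hhm hzm hhc (hrε hy)
      have h2 := aemeasurable_superposition hφm (hzm.add_const y) (hφc' _)
      have h3 := aemeasurable_superposition hφm hzm (hφc' _)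
      exact h1.norm.add (aemeasurable_const.max ((h3.add_const _).sub h2))
    have hFc : ∀ᵐ t ∂(timeMeasure T),
        ContinuousOn (fun y => F k y t) (Metric.closedBall (0 : Vec n) r) := by
      filter_upwards [hhc, hφc] with t h1 h2
      refine ContinuousOn.add (ContinuousOn.norm fun y hy => ?_) (by fun_prop)
      refine ContinuousAt.continuousWithinAt (ContinuousAt.comp (g := fun x => h x t) ?_
        (by fun_prop))
      exact h1 _ (by simpa using hrε hy)
    obtain ⟨hN, x, hx, hxz⟩ := exists_aemeasurable_zero (isCompact_closedBall (0 : Vec n) r)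
      hFm hFc (hF0 k)
    refine measure_eq_zero_of_improvement hfeas hfin hr.le
      (fun z hz hzr => hloc z hz (hzr.trans (min_le_left _ _))) hN hx
      (aemeasurable_superposition hφm (hzm.add hx) (hφc' _))
      (e := 1 / ((k : ℝ) + 1)) (by positivity) ?_
    filter_upwards [hxz] with t ht htN
    obtain ⟨h1, h2⟩ := ht htN
    exact ⟨mem_closedBall_zero_iff.1 h1, (hFzero k _ t).1 h2⟩
  -- Any strict improvement exceeds some `1/(k+1)`, so countably many null sets cover all bad times.
  filter_upwards [ae_all_iff.2 fun k => measure_eq_zero_iff_ae_notMem.1 (hnull k)] with t ht y hy hyt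
  by_contra! hlt
  obtain ⟨k, hk⟩ := exists_nat_one_div_lt (sub_pos.2 hlt)
  refine ht k ⟨y - zbar t, ?_, (hFzero k _ t).2 ?_⟩
  · rwa [mem_closedBall_zero_iff, ← mem_closedBall_iff_norm]
  · rw [add_sub_cancel]
    exact ⟨hyt, by linarith⟩

end ContTimeOpt

end

/-! ### Assembly of the necessary conditions -/

open ContTimeOpt in
theorem mainTheorem2 (T : ℝ) (hT : 0 < T) (n p : ℕ) (hpn : p ≤ n)
    (φ : ContTimeOpt.Vec n → ℝ → ℝ) (h : ContTimeOpt.Vec n → ℝ → ContTimeOpt.Vec p)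
    (zbar : ContTimeOpt.LInf T n) (ε : ℝ) (hε : 0 < ε)
    (hopt : ContTimeOpt.IsLocalSolution φ h zbar)
    (h1 : ContTimeOpt.H1 φ zbar) (h2 : ContTimeOpt.H2 h zbar ε)
    (h3 : ContTimeOpt.H3 h zbar ε) (h4 : ContTimeOpt.H4 h zbar) :
    ∃ u : ContTimeOpt.LInf T p,
      ContTimeOpt.Stationary φ h zbar u ∧
      (∀ v : ContTimeOpt.LInf T p, ContTimeOpt.Stationary φ h zbar v → v = u) ∧
      ∀ γ ∈ ContTimeOpt.criticalDirections h zbar,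
        AEMeasurable (ContTimeOpt.secondVariation φ h zbar u γ) (ContTimeOpt.timeMeasure T) ∧
        ∫⁻ t, ENNReal.ofReal (ContTimeOpt.secondVariation φ h zbar u γ t)
          ∂(ContTimeOpt.timeMeasure T) < ∞ ∧
        ContTimeOpt.extIntegral (ContTimeOpt.secondVariation φ h zbar u γ)
          (ContTimeOpt.timeMeasure T) ≤ 0 := by
  obtain ⟨hφ2, hφm, Kφ, -, hφb⟩ := h1
  obtain ⟨hhm, hh2⟩ := h2
  obtain ⟨-, K₀, -, hhb⟩ := h3
  obtain ⟨K, hK, hdet⟩ := h4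
  have hmeas : ∀ {m : ℕ} (w : LInf T m), AEMeasurable (w : ℝ → Vec m) (timeMeasure T) :=
    fun w => (Lp.aestronglyMeasurable w).aemeasurable
  have hφC : ∀ᵐ t ∂(timeMeasure T), ContDiff ℝ 2 fun x => φ x t :=
    (ae_restrict_iff' measurableSet_Icc).2 (ae_of_all _ hφ2)
  have hhC : ∀ᵐ t ∂(timeMeasure T), ∀ x ∈ Metric.ball (zbar t) ε,
      ContDiffAt ℝ 2 (fun x => h x t) x :=
    hh2.mono fun t ht x hx => ht.contDiffAt (mem_of_superset (Metric.isOpen_ball.mem_nhds hx)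
      Metric.ball_subset_closedBall)
  have hhd : ∀ᵐ t ∂(timeMeasure T), ∀ x ∈ Metric.ball (zbar t) ε,
      DifferentiableAt ℝ (fun x => h x t) x :=
    hhC.mono fun t ht x hx => (ht x hx).differentiableAt (by norm_num)
  obtain ⟨r, hr, hpt⟩ := ae_pointwise_local_solution hε hopt hφm (hφC.mono fun t ht => ht.continuous)
    hhm (hhd.mono fun t ht x hx => (ht x hx).continuousAt)
  have hmax : ∀ᵐ t ∂(timeMeasure T),
      IsLocalMaxOn (fun x => φ x t) {y | h y t = h (zbar t) t} (zbar t) := by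
    filter_upwards [hpt, hopt.1] with t ht hz
    refine eventually_nhdsWithin_iff.2 ?_
    filter_upwards [Metric.closedBall_mem_nhds (zbar t) hr] with y hy hyz
    exact ht y hy (hyz.trans hz)
  let A : ℝ → Vec n →L[ℝ] Vec p := fun t => jacobian (fun x => h x t) (zbar t)
  let g : ℝ → Vec n := fun t => gradient (fun x => φ x t) (zbar t)
  have hAm : AEMeasurable A (timeMeasure T) := aemeasurable_clm fun v => by
    simpa [A, jacobian] using aemeasurable_fderiv_shift hhm (hmeas zbar) hhd (Metric.mem_ball_self hε) v
  have hgm : AEMeasurable g (timeMeasure T) := aemeasurable_gradient hφm (hmeas zbar) hε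
    (hφC.mono fun t ht x _ => ht.contDiffAt.differentiableAt (by norm_num))
  have hne : ∀ᵐ t ∂(timeMeasure T), gramDet (A t) ≠ 0 :=
    hdet.mono fun t ht => (hK.trans_le ht).ne'
  let q : ℝ → (Vec n →L[ℝ] Vec p) × Vec n := fun t => (A t, g t)
  have hq : AEMeasurable q (timeMeasure T) := hAm.prodMk hgm
  have hqb : ∀ᵐ t ∂(timeMeasure T), q t ∈ boundedPairs n p K₀ K Kφ := by
    filter_upwards [hhb, hdet, hφb] with t a b c using ⟨a, b, c⟩
  have hu : MemLp (fun t => multiplier (q t).1 (q t).2) ∞ (timeMeasure T) :=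
    memLp_multiplier hK hq hqb
  have hsum : ∀ᵐ t ∂(timeMeasure T), ∀ v : Vec p,
      ∑ i, v i • gradient (fun x => h x t i) (zbar t) = ContinuousLinearMap.adjoint (A t) v :=
    hhd.mono fun t ht v => sum_smul_gradient_coord (ht _ (Metric.mem_ball_self hε)) v
  have hstat : Stationary φ h zbar (hu.toLp _) := by
    change ∀ᵐ t ∂(timeMeasure T), _
    filter_upwards [hu.coeFn_toLp, hsum, hφC, hhC, hne, hmax] with t a b c d e f
    obtain ⟨v, hv⟩ := exists_multiplier_of_isLocalMaxOn c.contDiffAt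
      (d _ (Metric.mem_ball_self hε)) e f
    rw [b, a, ← eq_multiplier e hv]
    exact hv
  refine ⟨hu.toLp _, hstat, fun v hv => Lp.ext ?_, fun γ hγ => ?_⟩
  · filter_upwards [hu.coeFn_toLp, hsum, hne, hv] with t a b c d
    rw [b] at d
    rw [a, eq_multiplier c d]
  have hnonpos : ∀ᵐ t ∂(timeMeasure T), secondVariation φ h zbar (hu.toLp _) γ t ≤ 0 := by
    filter_upwards [hφC, hhC, hne, hmax, hstat, hγ] with t a b c d e f
    exact inner_hessian_nonpos_of_isLocalMaxOn a.contDiffAt (b _ (Metric.mem_ball_self hε)) c d e f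
  -- The positive part vanishes almost everywhere, so the extended integral reduces to minus the
  -- integral of the negative part.
  have hzero : ∫⁻ t, ENNReal.ofReal (secondVariation φ h zbar (hu.toLp _) γ t)
      ∂(timeMeasure T) = 0 := by
    rw [lintegral_congr_ae (g := fun _ => 0) (hnonpos.mono fun t ht => ENNReal.ofReal_of_nonpos ht),
      lintegral_zero]
  refine ⟨?_, by rw [hzero]; exact ENNReal.zero_lt_top, ?_⟩
  · have hcoord : ∀ {m : ℕ} {w : ℝ → Vec m}, AEMeasurable w (timeMeasure T) → ∀ i,
        AEMeasurable (fun t => w t i) (timeMeasure T) := fun hw i =>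
      (EuclideanSpace.proj i : Vec _ →L[ℝ] ℝ).continuous.measurable.comp_aemeasurable hw
    refine (hmeas γ).inner ?_
    simp only [add_apply, sum_apply, smul_apply]
    refine (aemeasurable_hessian_apply hφm (hmeas zbar) hε
      (hφC.mono fun t ht x _ => ht.contDiffAt) (hmeas γ)).add
      (Finset.aemeasurable_fun_sum _ fun i _ => (hcoord (hmeas _) i).smul
        (aemeasurable_hessian_apply (f := fun x t => h x t i) (fun x => hcoord (hhm x) i)
          (hmeas zbar) hε ?_ (hmeas γ)))
    exact hhC.mono fun t ht x hx => contDiffAt_euclidean.1 (ht x hx) i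
  · rw [extIntegral, hzero, EReal.coe_ennreal_zero, zero_sub, EReal.neg_le, neg_zero]
    exact EReal.coe_ennreal_nonneg _
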